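/- **Setting.** Let $N,K\ge 1$, $0\le\mu<1$, $P>0$, $T,\alpha_i\in\mathbb R$ (period $T$, time-switching ratio $\alpha_i$). For a fixed user $u_i$, let $x_k^{(m)},y_k^{(m)}$ ($1\le m\le N$, $0\le k\le K$) be independent standard real Gaussian variables. The channel gain from access point $m$ to port $k\in\{1,\dots,K\}$ of $u_i$ is $$g_k^{(m)}=\big(\sqrt{1-\mu^2}\,x_k^{(m)}+\mu x_0^{(m)}\big)+j\big(\sqrt{1-\mu^2}\,y_k^{(m)}+\mu y_0^{(m)}\big),$$ the power harvested at port $k$ is $Q_k=\sum_{m=1}^N P|g_k^{(m)}|^2$, the port $k^*\in\arg\max_k Q_k$ is activated, and the average harvested energy is $E_{avg}=(1-\alpha_i)T\,\mathbb E[Q_{k^*}]$. Put $$Y_k=\sum_{m=1}^N\Big[\Big(x_k^{(m)}+\tfrac{\mu}{\sqrt{1-\mu^2}}x_0^{(m)}\Big)^2+\Big(y_k^{(m)}+\tfrac{\mu}{\sqrt{1-\mu^2}}y_0^{(m)}\Big)^2\Big],\qquad Z=\max_{1\le k\le K}Y_k,$$ and $\psi_i=(1-\alpha_i)(1-\mu^2)TP$.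 For $b\ge 0$ and integers $M\ge 0$ let $Q_M(a,b)=\int_b^\infty x\,(x/a)^{M-1}e^{-(x^2+a^2)/2}I_{M-1}(ax)\,dx$ ($a>0$), $Q_M(0,b)=e^{-b^2/2}\sum_{j<M}\frac{(b^2/2)^j}{j!}$ be the Marcum Q-function, where $I_n$ is the modified Bessel function of the first kind ($I_{-1}=I_1$). **Theorem.** The variables $Q_{k^*}$ and $Z$ are integrable and $E_{avg}=\psi_i\,\mathbb E[Z]$. For $z\ge 0$, $$\Pr(Z<z)=\int_0^\infty\frac{r^{N-1}e^{-r/2}}{2^N\Gamma(N)}\Big[1-Q_N\Big(\sqrt{\tfrac{\mu^2r}{1-\mu^2}},\sqrt z\Big)\Big]^K dr .$$ For $z>0$ this integral may be differentiated in $z$ under the integral sign, with derivative $$f_Z(z)=K\int_0^\infty\frac{r^{N-1}e^{-r/2}}{2^{N+1}\Gamma(N)}\Big[1-Q_N\Big(\sqrt{\tfrac{\mu^2r}{1-\mu^2}},\sqrt z\Big)\Big]^{K-1}\Big[Q_N\Big(\sqrt{\tfrac{\mu^2r}{1-\mu^2}},\sqrt z\Big)-Q_{N-1}\Big(\sqrt{\tfrac{\mu^2r}{1-\mu^2}},\sqrt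 z\Big)\Big]dr,$$ $f_Z$ is a density of $Z$ on $(0,\infty)$, and, all the integrals converging, $$E_{avg}=\psi_i\int_0^\infty t f_Z(t)\,dt=\psi_i\int_0^\infty Kt\int_0^\infty\frac{r^{N-1}e^{-r/2}}{2^{N+1}\Gamma(N)}\Big[1-Q_N\Big(\sqrt{\tfrac{\mu^2r}{1-\mu^2}},\sqrt t\Big)\Big]^{K-1}\Big[Q_N\Big(\sqrt{\tfrac{\mu^2r}{1-\mu^2}},\sqrt t\Big)-Q_{N-1}\Big(\sqrt{\tfrac{\mu^2r}{1-\mu^2}},\sqrt t\Big)\Big]dr\,dt .$$ -/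

import Mathlib

open MeasureTheory ProbabilityTheory Set

/-- Modified Bessel function of the first kind of integer order `n`,
`I_n(z) = ∑ j, (z/2)^(2j+|n|) / (j! (j+|n|)!)`; recall that `I_{-n} = I_n` for integers `n`. -/
noncomputable def besselI (n : ℤ) (z : ℝ) : ℝ :=
  ∑' j : ℕ, (z / 2) ^ (2 * j + n.natAbs) / ((j.factorial : ℝ) * ((j + n.natAbs).factorial : ℝ))

/-- Marcum Q-function of order `M` for `a, b ≥ 0`:
`Q_M(a, b) = ∫_b^∞ x (x/a)^(M-1) exp(-(x²+a²)/2) I_{M-1}(a x) dx` for `a > 0`, and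
`Q_M(0, b) = exp(-b²/2) ∑_{j<M} (b²/2)^j / j!` (the limit as `a → 0`).
For the order `M = 0` the kernel is `I_{-1} = I_1`. -/
noncomputable def marcumQ (M : ℕ) (a b : ℝ) : ℝ :=
  if a = 0 then
    Real.exp (-b ^ 2 / 2) * ∑ j ∈ Finset.range M, (b ^ 2 / 2) ^ j / (j.factorial : ℝ)
  else
    ∫ x in Ioi b, x * (x / a) ^ ((M : ℤ) - 1) * Real.exp (-(x ^ 2 + a ^ 2) / 2) *
      besselI ((M : ℤ) - 1) (a * x)

/-- Channel gain from one access point to port `k`; index `0` of `x` and `y` is the component that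
is common to all the ports, and port `k` has its own components at index `k + 1`. -/
noncomputable def channelGain {Ω : Type*} {K : ℕ} (μ : ℝ) (x y : Fin (K + 1) → Ω → ℝ)
    (k : Fin K) (ω : Ω) : ℂ :=
  ((Real.sqrt (1 - μ ^ 2) * x k.succ ω + μ * x 0 ω : ℝ) : ℂ) +
    Complex.I * ((Real.sqrt (1 - μ ^ 2) * y k.succ ω + μ * y 0 ω : ℝ) : ℂ)

/-- Power harvested at port `k` from `N` access points with transmission powers `P m`. -/
noncomputable def harvestPower {Ω : Type*} {N K : ℕ} (P : Fin N → ℝ) (μ : ℝ)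
    (x y : Fin N → Fin (K + 1) → Ω → ℝ) (k : Fin K) (ω : Ω) : ℝ :=
  ∑ m, P m * ‖channelGain μ (x m) (y m) k ω‖ ^ 2

/-- The normalized power `Y_k` at port `k`. -/
noncomputable def normalizedPower {Ω : Type*} {N K : ℕ} (μ : ℝ)
    (x y : Fin N → Fin (K + 1) → Ω → ℝ) (k : Fin K) (ω : Ω) : ℝ :=
  ∑ m, ((x m k.succ ω + μ / Real.sqrt (1 - μ ^ 2) * x m 0 ω) ^ 2 +
    (y m k.succ ω + μ / Real.sqrt (1 - μ ^ 2) * y m 0 ω) ^ 2)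

/-- `Z = max_k Y_k`. -/
noncomputable def maxNormalizedPower {Ω : Type*} {N K : ℕ} (μ : ℝ)
    (x y : Fin N → Fin (K + 1) → Ω → ℝ) (ω : Ω) : ℝ :=
  ⨆ k : Fin K, normalizedPower μ x y k ω

/-- Average harvested energy in the energy slot, of length `(1 - α) T`, when port `kstar ω` is
activated. -/
noncomputable def avgHarvestedEnergy {Ω : Type*} [MeasurableSpace Ω] (ρ : Measure Ω) {N K : ℕ}
    (α T : ℝ) (P : Fin N → ℝ) (μ : ℝ) (x y : Fin N → Fin (K + 1) → Ω → ℝ) (kstar : Ω → Fin K) : ℝ :=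
  (1 - α) * T * ∫ ω, harvestPower P μ x y (kstar ω) ω ∂ρ

/-- Integrand (in `r`) of the outage probability at the normalized threshold `z`. -/
noncomputable def outageIntegrand (N K : ℕ) (μ z r : ℝ) : ℝ :=
  r ^ (N - 1) * Real.exp (-r / 2) / (2 ^ N * Real.Gamma N) *
    (1 - marcumQ N (Real.sqrt (μ ^ 2 * r / (1 - μ ^ 2))) (Real.sqrt z)) ^ K

/-- Integrand (in `r`) of the density of `Z` at `t`, without the factor `K`. -/
noncomputable def densityIntegrand (N K : ℕ) (μ t r : ℝ) : ℝ :=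
  r ^ (N - 1) * Real.exp (-r / 2) / (2 ^ (N + 1) * Real.Gamma N) *
    (1 - marcumQ N (Real.sqrt (μ ^ 2 * r / (1 - μ ^ 2))) (Real.sqrt t)) ^ (K - 1) *
    (marcumQ N (Real.sqrt (μ ^ 2 * r / (1 - μ ^ 2))) (Real.sqrt t) -
      marcumQ (N - 1) (Real.sqrt (μ ^ 2 * r / (1 - μ ^ 2))) (Real.sqrt t))

/-- The density `f_Z` on `(0, ∞)`. -/
noncomputable def maxDensity (N K : ℕ) (μ t : ℝ) : ℝ :=
  K * ∫ r in Ioi (0 : ℝ), densityIntegrand N K μ t r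

/-! The Marcum Q-function `Q_M(a, b)` is the mixture, with Poisson weights of parameter `a² / 2`,
of the tails at `b²` of the chi-squared laws with `2 (M + k)` degrees of freedom. Hence
`1 - Q_N(a, √z)` is the distribution function of the noncentral chi-squared law, which a
comparison of characteristic functions identifies with the law of `∑ (wᵢ + aᵢ)²` for `2 N`
standard Gaussians `wᵢ` and `∑ aᵢ² = a²`. Given the components shared by the ports, the `Y_k` are
therefore i.i.d. noncentral chi-squared with noncentrality `μ² r / (1 - μ²)`, where `r`, the
squared norm of these components, is itself chi-squared. Averaging the `K`-th power of the
conditional distribution function over `r` gives the law of `Z`, and the derivative in `z` is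
dominated by a multiple of the chi-squared density of `r`, so that it passes under the integral.
-/

open Filter Topology

section PoissonWeight

/-- The probability that a Poisson variable of parameter `u` takes the value `k`. -/
noncomputable def poissonWeight (k : ℕ) (u : ℝ) : ℝ :=
  Real.exp (-u) * u ^ k / (k.factorial : ℝ)

lemma poissonWeight_nonneg (k : ℕ) {u : ℝ} (hu : 0 ≤ u) : 0 ≤ poissonWeight k u := by
  unfold poissonWeight; positivity

lemma hasSum_poissonWeight (u : ℝ) : HasSum (fun k => poissonWeight k u) 1 := by
  have h := (NormedSpace.expSeries_div_hasSum_exp (𝔸 := ℝ) u).mul_left (Real.exp (-u))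
  rw [← Real.exp_eq_exp_ℝ, ← Real.exp_add, neg_add_cancel, Real.exp_zero] at h
  simpa only [poissonWeight, mul_div_assoc] using h

lemma poissonWeight_le_one (k : ℕ) {u : ℝ} (hu : 0 ≤ u) : poissonWeight k u ≤ 1 :=
  le_hasSum (hasSum_poissonWeight u) k fun j _ => poissonWeight_nonneg j hu

lemma poissonWeight_zero_left (u : ℝ) : poissonWeight 0 u = Real.exp (-u) := by
  simp [poissonWeight]

lemma poissonWeight_succ_zero (k : ℕ) : poissonWeight (k + 1) 0 = 0 := by
  simp [poissonWeight]

@[fun_prop]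
lemma continuous_poissonWeight (k : ℕ) : Continuous (poissonWeight k) := by
  unfold poissonWeight; fun_prop

lemma hasDerivAt_poissonWeight_zero (u : ℝ) :
    HasDerivAt (poissonWeight 0) (-poissonWeight 0 u) u := by
  have h := (hasDerivAt_neg u).exp
  rw [mul_neg, mul_one] at h
  rw [show poissonWeight 0 = fun u => Real.exp (-u) from funext poissonWeight_zero_left]
  exact h

lemma hasDerivAt_poissonWeight_succ (k : ℕ) (u : ℝ) :
    HasDerivAt (poissonWeight (k + 1)) (poissonWeight k u - poissonWeight (k + 1) u) u := by
  have h := (((hasDerivAt_neg u).exp).mul (hasDerivAt_pow (k + 1) u)).div_const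
    ((k + 1).factorial : ℝ)
  convert! h using 1
  simp only [poissonWeight, Nat.factorial_succ]
  push_cast
  have h1 : ((k : ℝ) + 1) ≠ 0 := by positivity
  have h2 : (k.factorial : ℝ) ≠ 0 := by positivity
  field_simp
  ring

lemma tendsto_poissonWeight_atTop (k : ℕ) : Tendsto (poissonWeight k) atTop (𝓝 0) := by
  have h := (Real.tendsto_pow_mul_exp_neg_atTop_nhds_zero k).div_const (k.factorial : ℝ)
  rw [zero_div] at h
  exact h.congr fun u => by rw [poissonWeight, mul_comm]

end PoissonWeight

section PoissonMixture

/-- The expectation of `c J` for a Poisson variable `J` of parameter `l`: the mixture of the values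
`c j` with Poisson weights. -/
noncomputable def poissonMixture (l : ℝ) (c : ℕ → ℝ) : ℝ := ∑' j, poissonWeight j l * c j

variable {l : ℝ}

lemma poissonMixture_zero_left (c : ℕ → ℝ) : poissonMixture 0 c = c 0 := by
  rw [poissonMixture, tsum_eq_single 0 fun j hj => ?_]
  · simp [poissonWeight_zero_left]
  · obtain ⟨j, rfl⟩ := Nat.exists_eq_succ_of_ne_zero hj
    rw [poissonWeight_succ_zero, zero_mul]

lemma poissonMixture_one (l : ℝ) : poissonMixture l (fun _ => 1) = 1 := by
  simp only [poissonMixture, mul_one, (hasSum_poissonWeight l).tsum_eq]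

lemma poissonMixture_zero (l : ℝ) : poissonMixture l (fun _ => 0) = 0 := by
  simp only [poissonMixture, mul_zero, tsum_zero]

lemma poissonMixture_nonneg (hl : 0 ≤ l) {c : ℕ → ℝ} (hc : ∀ j, 0 ≤ c j) :
    0 ≤ poissonMixture l c :=
  tsum_nonneg fun j => mul_nonneg (poissonWeight_nonneg j hl) (hc j)

lemma norm_poissonWeight_mul_le (hl : 0 ≤ l) (j : ℕ) {a : ℝ} (ha : |a| ≤ 1) :
    ‖poissonWeight j l * a‖ ≤ poissonWeight j l := by
  rw [norm_mul, Real.norm_of_nonneg (poissonWeight_nonneg j hl)]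
  exact mul_le_of_le_one_right (poissonWeight_nonneg j hl) ha

lemma summable_poissonWeight_mul (hl : 0 ≤ l) {c : ℕ → ℝ} (hc : ∀ j, |c j| ≤ 1) :
    Summable fun j => poissonWeight j l * c j :=
  Summable.of_norm_bounded (hasSum_poissonWeight l).summable
    fun j => norm_poissonWeight_mul_le hl j (hc j)

lemma abs_poissonMixture_le_one (hl : 0 ≤ l) {c : ℕ → ℝ} (hc : ∀ j, |c j| ≤ 1) :
    |poissonMixture l c| ≤ 1 :=
  tsum_of_norm_bounded (hasSum_poissonWeight l) fun j => norm_poissonWeight_mul_le hl j (hc j)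

lemma poissonMixture_sub (hl : 0 ≤ l) {c d : ℕ → ℝ} (hc : ∀ j, |c j| ≤ 1) (hd : ∀ j, |d j| ≤ 1) :
    poissonMixture l c - poissonMixture l d = poissonMixture l fun j => c j - d j := by
  simp only [poissonMixture, mul_sub]
  exact ((summable_poissonWeight_mul hl hc).tsum_sub (summable_poissonWeight_mul hl hd)).symm

lemma poissonMixture_const_mul (l a : ℝ) (c : ℕ → ℝ) :
    poissonMixture l (fun j => a * c j) = a * poissonMixture l c := by
  simp only [poissonMixture, mul_left_comm _ a, tsum_mul_left]

lemma measurable_poissonMixture (c : ℕ → ℝ) : Measurable fun l => poissonMixture l c :=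
  .tsum fun j => ((continuous_poissonWeight j).mul_const (c j)).measurable

lemma hasDerivAt_poissonMixture (hl : 0 ≤ l) {U : Set ℝ} (hU : IsOpen U) (hU' : IsPreconnected U)
    {f f' : ℕ → ℝ → ℝ} (hf : ∀ j, ∀ u ∈ U, HasDerivAt (f j) (f' j u) u)
    (hf' : ∀ j, ∀ u ∈ U, |f' j u| ≤ 1) {s : ℝ} (hs : s ∈ U) (hfs : ∀ j, |f j s| ≤ 1) :
    HasDerivAt (fun u => poissonMixture l fun j => f j u) (poissonMixture l fun j => f' j s) s :=
  hasDerivAt_tsum_of_isPreconnected (hasSum_poissonWeight l).summable hU hU'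
    (fun j u hu => (hf j u hu).const_mul (poissonWeight j l))
    (fun j u hu => norm_poissonWeight_mul_le hl j (hf' j u hu)) hs
    (summable_poissonWeight_mul hl hfs) hs

lemma continuousOn_poissonMixture (hl : 0 ≤ l) {S : Set ℝ} {f : ℕ → ℝ → ℝ}
    (hf : ∀ j, ContinuousOn (f j) S) (hf1 : ∀ j, ∀ u ∈ S, |f j u| ≤ 1) :
    ContinuousOn (fun u => poissonMixture l fun j => f j u) S :=
  continuousOn_tsum (fun j => (hf j).const_mul (poissonWeight j l))
    (hasSum_poissonWeight l).summable fun j u hu => norm_poissonWeight_mul_le hl j (hf1 j u hu)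

lemma tendsto_poissonMixture (hl : 0 ≤ l) {ι : Type*} {F : Filter ι} {f : ℕ → ι → ℝ} {c : ℕ → ℝ}
    (hf : ∀ j, Tendsto (f j) F (𝓝 (c j))) (hf1 : ∀ᶠ u in F, ∀ j, |f j u| ≤ 1) :
    Tendsto (fun u => poissonMixture l fun j => f j u) F (𝓝 (poissonMixture l c)) :=
  tendsto_tsum_of_dominated_convergence (hasSum_poissonWeight l).summable
    (fun j => (hf j).const_mul (poissonWeight j l))
    (hf1.mono fun _ hu j => norm_poissonWeight_mul_le hl j (hu j))

end PoissonMixture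

section ChiSq

/-- The probability that a chi-squared variable with `2 * n` degrees of freedom exceeds `s ≥ 0`,
written as the probability that a Poisson variable of parameter `s / 2` is less than `n`. -/
noncomputable def chiSqTail (n : ℕ) (s : ℝ) : ℝ := ∑ k ∈ Finset.range n, poissonWeight k (s / 2)

/-- The density on `(0, ∞)` of the chi-squared distribution with `2 * n` degrees of freedom; it is
`0` for `n = 0`, where the distribution is a point mass at `0`. -/
noncomputable def chiSqDensity : ℕ → ℝ → ℝ
  | 0, _ => 0
  | n + 1, s => poissonWeight n (s / 2) / 2

lemma chiSqTail_succ (n : ℕ) (s : ℝ) :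
    chiSqTail (n + 1) s = chiSqTail n s + 2 * chiSqDensity (n + 1) s := by
  rw [chiSqTail, Finset.sum_range_succ, chiSqTail, chiSqDensity]
  ring

lemma chiSqTail_nonneg (n : ℕ) {s : ℝ} (hs : 0 ≤ s) : 0 ≤ chiSqTail n s :=
  Finset.sum_nonneg fun k _ => poissonWeight_nonneg k (by positivity)

lemma abs_chiSqTail_le_one (n : ℕ) {s : ℝ} (hs : 0 ≤ s) : |chiSqTail n s| ≤ 1 := by
  rw [abs_of_nonneg (chiSqTail_nonneg n hs)]
  exact sum_le_hasSum _ (fun k _ => poissonWeight_nonneg k (by positivity))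
    (hasSum_poissonWeight (s / 2))

lemma chiSqTail_zero_right {n : ℕ} (hn : n ≠ 0) : chiSqTail n 0 = 1 := by
  obtain ⟨n, rfl⟩ := Nat.exists_eq_succ_of_ne_zero hn
  simp [chiSqTail, Finset.sum_range_succ', poissonWeight_succ_zero, poissonWeight_zero_left]

@[fun_prop]
lemma continuous_chiSqTail (n : ℕ) : Continuous (chiSqTail n) := by
  unfold chiSqTail; fun_prop

lemma tendsto_chiSqTail_atTop (n : ℕ) : Tendsto (chiSqTail n) atTop (𝓝 0) := by
  have h := tendsto_finsetSum (Finset.range n) fun k _ =>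
    (tendsto_poissonWeight_atTop k).comp (tendsto_id.atTop_div_const (zero_lt_two (α := ℝ)))
  rwa [Finset.sum_const_zero] at h

lemma chiSqDensity_nonneg (n : ℕ) {s : ℝ} (hs : 0 ≤ s) : 0 ≤ chiSqDensity n s := by
  cases n with
  | zero => exact le_rfl
  | succ n => exact div_nonneg (poissonWeight_nonneg n (by positivity)) zero_le_two

lemma abs_chiSqDensity_le_one (n : ℕ) {s : ℝ} (hs : 0 ≤ s) : |chiSqDensity n s| ≤ 1 := by
  rw [abs_of_nonneg (chiSqDensity_nonneg n hs)]
  cases n with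
  | zero => exact zero_le_one
  | succ n =>
    rw [chiSqDensity]
    linarith [poissonWeight_le_one n (div_nonneg hs zero_le_two)]

@[fun_prop]
lemma continuous_chiSqDensity (n : ℕ) : Continuous (chiSqDensity n) := by
  cases n <;> unfold chiSqDensity <;> fun_prop

lemma tendsto_chiSqDensity_atTop (n : ℕ) : Tendsto (chiSqDensity n) atTop (𝓝 0) := by
  cases n with
  | zero => exact tendsto_const_nhds
  | succ n =>
    have h := ((tendsto_poissonWeight_atTop n).comp
      (tendsto_id.atTop_div_const (zero_lt_two (α := ℝ)))).div_const 2
    rwa [zero_div] at h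

lemma hasDerivAt_chiSqDensity_succ (n : ℕ) (s : ℝ) :
    HasDerivAt (chiSqDensity (n + 1)) ((chiSqDensity n s - chiSqDensity (n + 1) s) / 2) s := by
  have half : HasDerivAt (fun s : ℝ => s / 2) (1 / 2) s := (hasDerivAt_id s).div_const 2
  cases n with
  | zero =>
    convert! ((hasDerivAt_poissonWeight_zero (s / 2)).comp s half).div_const 2 using 1
    simp only [chiSqDensity]
    ring
  | succ n =>
    convert! ((hasDerivAt_poissonWeight_succ n (s / 2)).comp s half).div_const 2 using 1
    simp only [chiSqDensity]
    ring

lemma hasDerivAt_chiSqTail (n : ℕ) (s : ℝ) : HasDerivAt (chiSqTail n) (-chiSqDensity n s) s := by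
  induction n with
  | zero =>
    rw [chiSqDensity, neg_zero]
    exact hasDerivAt_const s 0
  | succ n ih =>
    rw [show chiSqTail (n + 1) = fun s => chiSqTail n s + 2 * chiSqDensity (n + 1) s from
      funext (chiSqTail_succ n)]
    convert! ih.add ((hasDerivAt_chiSqDensity_succ n s).const_mul 2) using 1
    ring

end ChiSq

section NoncentralChiSq

/-- The probability that a noncentral chi-squared variable with `2 * N` degrees of freedom and
noncentrality parameter `l` exceeds `s ≥ 0`. -/
noncomputable def noncentralChiSqTail (N : ℕ) (l s : ℝ) : ℝ :=
  poissonMixture (l / 2) fun j => chiSqTail (N + j) s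

/-- The density on `(0, ∞)` of the noncentral chi-squared distribution with `2 * N` degrees of
freedom and noncentrality parameter `l`. -/
noncomputable def noncentralChiSqDensity (N : ℕ) (l s : ℝ) : ℝ :=
  poissonMixture (l / 2) fun j => chiSqDensity (N + j) s

variable {l s : ℝ}

lemma noncentralChiSqTail_nonneg (N : ℕ) (hl : 0 ≤ l) (hs : 0 ≤ s) :
    0 ≤ noncentralChiSqTail N l s :=
  poissonMixture_nonneg (by positivity) fun _ => chiSqTail_nonneg _ hs

lemma noncentralChiSqTail_le_one (N : ℕ) (hl : 0 ≤ l) (hs : 0 ≤ s) :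
    noncentralChiSqTail N l s ≤ 1 :=
  (le_abs_self _).trans
    (abs_poissonMixture_le_one (by positivity) fun _ => abs_chiSqTail_le_one _ hs)

lemma noncentralChiSqTail_zero_right {N : ℕ} (hN : N ≠ 0) (l : ℝ) :
    noncentralChiSqTail N l 0 = 1 := by
  have h : ∀ j, chiSqTail (N + j) 0 = 1 := fun j => chiSqTail_zero_right (by omega)
  simp only [noncentralChiSqTail, h, poissonMixture_one]

lemma noncentralChiSqDensity_nonneg (N : ℕ) (hl : 0 ≤ l) (hs : 0 ≤ s) :
    0 ≤ noncentralChiSqDensity N l s :=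
  poissonMixture_nonneg (by positivity) fun _ => chiSqDensity_nonneg _ hs

lemma noncentralChiSqDensity_le_one (N : ℕ) (hl : 0 ≤ l) (hs : 0 ≤ s) :
    noncentralChiSqDensity N l s ≤ 1 :=
  (le_abs_self _).trans
    (abs_poissonMixture_le_one (by positivity) fun _ => abs_chiSqDensity_le_one _ hs)

lemma noncentralChiSqTail_succ_sub (n : ℕ) (hl : 0 ≤ l) (hs : 0 ≤ s) :
    noncentralChiSqTail (n + 1) l s - noncentralChiSqTail n l s =
      2 * noncentralChiSqDensity (n + 1) l s := by
  rw [noncentralChiSqTail, noncentralChiSqTail, noncentralChiSqDensity,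
    poissonMixture_sub (by positivity) (fun _ => abs_chiSqTail_le_one _ hs)
      (fun _ => abs_chiSqTail_le_one _ hs), ← poissonMixture_const_mul]
  congr with j
  rw [add_right_comm, chiSqTail_succ, add_sub_cancel_left]

lemma hasDerivAt_noncentralChiSqTail (N : ℕ) (hl : 0 ≤ l) (hs : 0 < s) :
    HasDerivAt (noncentralChiSqTail N l) (-noncentralChiSqDensity N l s) s := by
  have h := hasDerivAt_poissonMixture (l := l / 2) (by positivity) isOpen_Ioi isPreconnected_Ioi
    (fun j u _ => hasDerivAt_chiSqTail (N + j) u)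
    (fun j u hu => (abs_neg _).trans_le (abs_chiSqDensity_le_one (N + j) (le_of_lt hu))) hs
    (fun j => abs_chiSqTail_le_one (N + j) hs.le)
  convert! h using 1
  simpa [noncentralChiSqDensity] using
    (poissonMixture_const_mul (l / 2) (-1) fun j => chiSqDensity (N + j) s).symm

lemma continuousOn_noncentralChiSqTail (N : ℕ) (hl : 0 ≤ l) :
    ContinuousOn (noncentralChiSqTail N l) (Ici 0) :=
  continuousOn_poissonMixture (by positivity) (fun j => (continuous_chiSqTail (N + j)).continuousOn)
    fun j _ hu => abs_chiSqTail_le_one (N + j) hu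

lemma tendsto_noncentralChiSqTail_atTop (N : ℕ) (hl : 0 ≤ l) :
    Tendsto (noncentralChiSqTail N l) atTop (𝓝 0) := by
  have h := tendsto_poissonMixture (l := l / 2) (by positivity)
    (fun j => tendsto_chiSqTail_atTop (N + j))
    ((eventually_ge_atTop 0).mono fun _ hu j => abs_chiSqTail_le_one (N + j) hu)
  rwa [poissonMixture_zero] at h

lemma measurable_noncentralChiSqTail_left (N : ℕ) (s : ℝ) :
    Measurable fun l => noncentralChiSqTail N l s :=
  (measurable_poissonMixture _).comp (measurable_id.div_const 2)

lemma measurable_noncentralChiSqDensity_left (N : ℕ) (s : ℝ) :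
    Measurable fun l => noncentralChiSqDensity N l s :=
  (measurable_poissonMixture _).comp (measurable_id.div_const 2)

end NoncentralChiSq

section Marcum

/-- The Poisson mixture is the power series of the Bessel function, regrouped. -/
lemma marcumQ_integrand_eq (M : ℕ) {a x : ℝ} (ha : 0 < a) (hx : 0 < x) :
    x * (x / a) ^ ((M : ℤ) - 1) * Real.exp (-(x ^ 2 + a ^ 2) / 2) * besselI ((M : ℤ) - 1) (a * x) =
      2 * x * noncentralChiSqDensity M (a ^ 2) (x ^ 2) := by
  have hexp : Real.exp (-(x ^ 2 + a ^ 2) / 2) =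
      Real.exp (-(a ^ 2 / 2)) * Real.exp (-(x ^ 2 / 2)) := by
    rw [← Real.exp_add]; ring_nf
  rw [hexp, noncentralChiSqDensity, poissonMixture, besselI, ← tsum_mul_left, ← tsum_mul_left]
  cases M with
  | zero =>
    have hsum := summable_poissonWeight_mul (l := a ^ 2 / 2) (by positivity) fun j =>
      abs_chiSqDensity_le_one (0 + j) (sq_nonneg x)
    rw [(hsum.mul_left (2 * x)).tsum_eq_zero_add, zero_add, chiSqDensity, mul_zero, mul_zero,
      zero_add]
    refine tsum_congr fun j => ?_
    rw [zero_add, chiSqDensity, Nat.cast_zero, zero_sub, zpow_neg_one, Int.natAbs_neg,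
      Int.natAbs_one, poissonWeight, poissonWeight]
    field_simp
    ring
  | succ n =>
    refine tsum_congr fun j => ?_
    rw [Nat.cast_succ, add_sub_cancel_right, Int.natAbs_natCast, zpow_natCast, add_right_comm,
      chiSqDensity, poissonWeight, poissonWeight, add_comm n j, div_pow]
    field_simp
    ring

lemma marcumQ_eq_noncentralChiSqTail (M : ℕ) {a b : ℝ} (ha : 0 ≤ a) (hb : 0 ≤ b) :
    marcumQ M a b = noncentralChiSqTail M (a ^ 2) (b ^ 2) := by
  rcases ha.eq_or_lt with rfl | ha
  · rw [marcumQ, if_pos rfl, noncentralChiSqTail, zero_pow two_ne_zero, zero_div,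
      poissonMixture_zero_left]
    simp only [add_zero, chiSqTail, poissonWeight, Finset.mul_sum, mul_div_assoc, neg_div]
  · set G : ℝ → ℝ := fun x => -noncentralChiSqTail M (a ^ 2) (x ^ 2)
    have hcont : ContinuousWithinAt G (Ici b) b :=
      ((continuousOn_noncentralChiSqTail M (sq_nonneg a)).comp
        (continuous_pow 2).continuousOn fun x _ => sq_nonneg x).neg b self_mem_Ici
    have hderiv : ∀ x ∈ Ioi b,
        HasDerivAt G (2 * x * noncentralChiSqDensity M (a ^ 2) (x ^ 2)) x := fun x hx => by
      have hsq : HasDerivAt (fun x : ℝ => x ^ 2) (2 * x) x := by simpa using hasDerivAt_pow 2 x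
      have hx2 : 0 < x ^ 2 := pow_pos (hb.trans_lt hx) 2
      convert! (HasDerivAt.comp x (h := fun x => x ^ 2)
        (hasDerivAt_noncentralChiSqTail M (sq_nonneg a) hx2) hsq).neg using 1
      ring
    have hnonneg : ∀ x ∈ Ioi b, 0 ≤ 2 * x * noncentralChiSqDensity M (a ^ 2) (x ^ 2) :=
      fun x hx => mul_nonneg (mul_nonneg zero_le_two (hb.trans (le_of_lt hx)))
        (noncentralChiSqDensity_nonneg M (sq_nonneg a) (sq_nonneg x))
    have hlim : Tendsto G atTop (𝓝 0) := by
      simpa using ((tendsto_noncentralChiSqTail_atTop M (sq_nonneg a)).comp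
        (tendsto_pow_atTop two_ne_zero)).neg
    rw [marcumQ, if_neg ha.ne', setIntegral_congr_fun measurableSet_Ioi
      (fun x hx => marcumQ_integrand_eq M ha (hb.trans_lt hx)),
      integral_Ioi_of_hasDerivAt_of_nonneg hcont hderiv hnonneg hlim, zero_sub, neg_neg]

lemma marcumQ_sqrt_sqrt (M : ℕ) {l s : ℝ} (hl : 0 ≤ l) (hs : 0 ≤ s) :
    marcumQ M (Real.sqrt l) (Real.sqrt s) = noncentralChiSqTail M l s := by
  rw [marcumQ_eq_noncentralChiSqTail M (Real.sqrt_nonneg l) (Real.sqrt_nonneg s),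
    Real.sq_sqrt hl, Real.sq_sqrt hs]

end Marcum

section DensityOfIio

variable {G g : ℝ → ℝ}

lemma withDensity_ofReal_deriv_Iio (hG : ContinuousOn G (Ici 0))
    (hderiv : ∀ t, 0 < t → HasDerivAt G (g t) t) (hg : ∀ t, 0 < t → 0 ≤ g t) {z : ℝ} (hz : 0 ≤ z) :
    (volume.restrict (Ioi (0 : ℝ))).withDensity (fun t => ENNReal.ofReal (g t)) (Iio z) =
      ENNReal.ofReal (G z - G 0) := by
  have hc : ContinuousOn G (Icc 0 z) := hG.mono Icc_subset_Ici_self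
  have hd : ∀ t ∈ Ioo 0 z, HasDerivAt G (g t) t := fun t ht => hderiv t ht.1
  have hi : IntegrableOn g (Ioc 0 z) :=
    intervalIntegral.integrableOn_deriv_of_nonneg hc hd fun t ht => hg t ht.1
  rw [withDensity_apply _ measurableSet_Iio, Measure.restrict_restrict measurableSet_Iio,
    inter_comm, Ioi_inter_Iio, Measure.restrict_congr_set Ioo_ae_eq_Ioc,
    ← ofReal_integral_eq_lintegral_ofReal hi
      (ae_restrict_of_forall_mem measurableSet_Ioc fun t ht => hg t ht.1),
    ← intervalIntegral.integral_of_le hz, intervalIntegral.integral_eq_sub_of_hasDerivAt_of_le hz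
      hc hd ((intervalIntegrable_iff_integrableOn_Ioc_of_le hz).2 hi)]

lemma measure_ext_of_Iio {μ ν : Measure ℝ} [IsFiniteMeasure μ] (h : ∀ a, μ (Iio a) = ν (Iio a)) :
    μ = ν := by
  have hcover : ⋃ n : ℕ, Iio (n : ℝ) = univ :=
    iUnion_eq_univ_iff.2 fun x => exists_nat_gt x
  refine Measure.ext_of_generateFrom_of_iUnion (range Iio) (fun n : ℕ => Iio (n : ℝ))
    (borel_eq_generateFrom_Iio ℝ ▸ BorelSpace.measurable_eq) isPiSystem_Iio hcover
    (fun n => mem_range_self _) (fun n => measure_ne_top μ _) ?_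
  rintro _ ⟨a, rfl⟩
  exact h a

lemma eq_withDensity_ofReal_deriv {ν : Measure ℝ} [IsFiniteMeasure ν]
    (hG : ContinuousOn G (Ici 0)) (hderiv : ∀ t, 0 < t → HasDerivAt G (g t) t)
    (hg : ∀ t, 0 < t → 0 ≤ g t) (hν : ∀ z, 0 ≤ z → ν (Iio z) = ENNReal.ofReal (G z - G 0)) :
    ν = (volume.restrict (Ioi (0 : ℝ))).withDensity (fun t => ENNReal.ofReal (g t)) := by
  have hIio : ∀ z, 0 ≤ z → ν (Iio z) = (volume.restrict (Ioi (0 : ℝ))).withDensity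
      (fun t => ENNReal.ofReal (g t)) (Iio z) := fun z hz =>
    (hν z hz).trans (withDensity_ofReal_deriv_Iio hG hderiv hg hz).symm
  have hν0 : ν (Iio 0) = 0 := by rw [hν 0 le_rfl, sub_self, ENNReal.ofReal_zero]
  refine measure_ext_of_Iio fun z => ?_
  rcases le_total 0 z with hz | hz
  · exact hIio z hz
  · rw [measure_mono_null (Iio_subset_Iio hz) hν0,
      measure_mono_null (Iio_subset_Iio hz) ((hIio 0 le_rfl).symm.trans hν0)]

end DensityOfIio

section NoncentralChiSqMeasure

/-- The noncentral chi-squared distribution with `2 * N` degrees of freedom and noncentrality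
parameter `l`, for `N ≠ 0`; for `N = 0` its atom at `0` is left out. -/
noncomputable def noncentralChiSq (N : ℕ) (l : ℝ) : Measure ℝ :=
  (volume.restrict (Ioi (0 : ℝ))).withDensity
    (fun s => ENNReal.ofReal (noncentralChiSqDensity N l s))

variable {l : ℝ}

lemma integrableOn_noncentralChiSqDensity (N : ℕ) (hl : 0 ≤ l) :
    IntegrableOn (noncentralChiSqDensity N l) (Ioi 0) :=
  integrableOn_Ioi_deriv_of_nonneg ((continuousOn_noncentralChiSqTail N hl).neg 0 self_mem_Ici)
    (fun s hs => by simpa using (hasDerivAt_noncentralChiSqTail N hl hs).neg)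
    (fun s hs => noncentralChiSqDensity_nonneg N hl (le_of_lt hs))
    (tendsto_noncentralChiSqTail_atTop N hl).neg

lemma integral_noncentralChiSqDensity {N : ℕ} (hN : N ≠ 0) (hl : 0 ≤ l) :
    ∫ s in Ioi (0 : ℝ), noncentralChiSqDensity N l s = 1 := by
  rw [integral_Ioi_of_hasDerivAt_of_nonneg
    ((continuousOn_noncentralChiSqTail N hl).neg 0 self_mem_Ici)
    (fun s hs => by simpa using (hasDerivAt_noncentralChiSqTail N hl hs).neg)
    (fun s hs => noncentralChiSqDensity_nonneg N hl (le_of_lt hs))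
    (tendsto_noncentralChiSqTail_atTop N hl).neg]
  simp [noncentralChiSqTail_zero_right hN]

lemma isFiniteMeasure_noncentralChiSq (N : ℕ) (hl : 0 ≤ l) :
    IsFiniteMeasure (noncentralChiSq N l) :=
  isFiniteMeasure_withDensity_ofReal (integrableOn_noncentralChiSqDensity N hl).2

lemma noncentralChiSq_Iio {N : ℕ} (hN : N ≠ 0) (hl : 0 ≤ l) {z : ℝ} (hz : 0 ≤ z) :
    noncentralChiSq N l (Iio z) = ENNReal.ofReal (1 - noncentralChiSqTail N l z) := by
  rw [noncentralChiSq, withDensity_ofReal_deriv_Iio (continuousOn_noncentralChiSqTail N hl).neg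
    (fun s hs => by simpa using (hasDerivAt_noncentralChiSqTail N hl hs).neg)
    (fun s hs => noncentralChiSqDensity_nonneg N hl hs.le) hz]
  simp only [Pi.neg_apply, noncentralChiSqTail_zero_right hN]
  ring_nf

lemma noncentralChiSqDensity_zero (N : ℕ) : noncentralChiSqDensity N 0 = chiSqDensity N := by
  ext s
  rw [noncentralChiSqDensity, zero_div, poissonMixture_zero_left, add_zero]

lemma integrableOn_chiSqDensity (n : ℕ) : IntegrableOn (chiSqDensity n) (Ioi 0) :=
  noncentralChiSqDensity_zero n ▸ integrableOn_noncentralChiSqDensity n le_rfl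

lemma integral_chiSqDensity {n : ℕ} (hn : n ≠ 0) : ∫ s in Ioi (0 : ℝ), chiSqDensity n s = 1 :=
  noncentralChiSqDensity_zero n ▸ integral_noncentralChiSqDensity hn le_rfl

end NoncentralChiSqMeasure

section CharFun

open Complex

/-- The characteristic function of the chi-squared distribution with two degrees of freedom. -/
noncomputable def chiSqTwoCharFun (t : ℝ) : ℂ := (1 - 2 * t * I)⁻¹

lemma one_sub_two_mul_I_ne_zero (t : ℝ) : (1 - 2 * t * I : ℂ) ≠ 0 := by
  intro h
  simpa using congrArg Complex.re h

lemma norm_cexp_mul_ofReal (t s x : ℝ) : ‖cexp (t * s * I) * (x : ℂ)‖ = ‖x‖ := by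
  rw [norm_mul, ← Complex.ofReal_mul, Complex.norm_exp_ofReal_mul_I, one_mul, Complex.norm_real]

lemma integrableOn_cexp_mul {f : ℝ → ℝ} {S : Set ℝ} (hf : IntegrableOn f S) (t : ℝ) :
    IntegrableOn (fun s : ℝ => cexp (t * s * I) * (f s : ℂ)) S := by
  refine Integrable.mono hf ?_ (ae_of_all _ fun s => (norm_cexp_mul_ofReal t s (f s)).le)
  have : Continuous fun s : ℝ => cexp (t * s * I) := by fun_prop
  exact this.aestronglyMeasurable.mul
    (Complex.continuous_ofReal.comp_aestronglyMeasurable hf.aestronglyMeasurable)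

lemma hasDerivAt_cexp_mul {f : ℝ → ℝ} {f' s : ℝ} (hf : HasDerivAt f f' s) (t : ℝ) :
    HasDerivAt (fun s : ℝ => cexp (t * s * I) * (f s : ℂ))
      (t * I * (cexp (t * s * I) * (f s : ℂ)) + cexp (t * s * I) * (f' : ℂ)) s := by
  have hlin : HasDerivAt (fun s : ℝ => (t * s * I : ℂ)) (t * I) s := by
    simpa using ((Complex.ofRealCLM.hasDerivAt (x := s)).const_mul (t : ℂ)).mul_const I
  convert! hlin.cexp.mul hf.ofReal_comp using 1
  ring

lemma tendsto_cexp_mul {f : ℝ → ℝ} (hf : Tendsto f atTop (𝓝 0)) (t : ℝ) :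
    Tendsto (fun s : ℝ => cexp (t * s * I) * (f s : ℂ)) atTop (𝓝 0) := by
  rw [tendsto_zero_iff_norm_tendsto_zero]
  simpa only [norm_cexp_mul_ofReal, norm_zero] using hf.norm

/-- Integration by parts, using that the chi-squared densities satisfy
`2 χ_{n+1}' = χ_n - χ_{n+1}`. -/
lemma integral_cexp_mul_chiSqDensity_succ (n : ℕ) (t : ℝ) :
    (1 - 2 * t * I) * ∫ s in Ioi (0 : ℝ), cexp (t * s * I) * (chiSqDensity (n + 1) s : ℂ) =
      (∫ s in Ioi (0 : ℝ), cexp (t * s * I) * (chiSqDensity n s : ℂ)) +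
        2 * (chiSqDensity (n + 1) 0 : ℂ) := by
  have hint := fun k => integrableOn_cexp_mul (integrableOn_chiSqDensity k) t
  have hderiv : ∀ s ∈ Ici (0 : ℝ), HasDerivAt
      (fun s : ℝ => cexp (t * s * I) * (chiSqDensity (n + 1) s : ℂ))
      ((t * I - 1 / 2) * (cexp (t * s * I) * (chiSqDensity (n + 1) s : ℂ)) +
        1 / 2 * (cexp (t * s * I) * (chiSqDensity n s : ℂ))) s := fun s _ => by
    convert! hasDerivAt_cexp_mul (hasDerivAt_chiSqDensity_succ n s) t using 1
    push_cast
    ring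
  have hparts := integral_Ioi_of_hasDerivAt_of_tendsto' hderiv
    (((hint (n + 1)).const_mul _).add ((hint n).const_mul _))
    (tendsto_cexp_mul (tendsto_chiSqDensity_atTop (n + 1)) t)
  rw [integral_add ((hint (n + 1)).const_mul _) ((hint n).const_mul _), integral_const_mul,
    integral_const_mul, ofReal_zero, mul_zero, zero_mul, Complex.exp_zero, one_mul] at hparts
  linear_combination -2 * hparts

lemma integral_cexp_mul_chiSqDensity {n : ℕ} (hn : n ≠ 0) (t : ℝ) :
    ∫ s in Ioi (0 : ℝ), cexp (t * s * I) * (chiSqDensity n s : ℂ) = chiSqTwoCharFun t ^ n := by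
  induction n, Nat.one_le_iff_ne_zero.2 hn using Nat.le_induction with
  | base =>
    have h := integral_cexp_mul_chiSqDensity_succ 0 t
    rw [pow_one, chiSqTwoCharFun]
    refine eq_inv_of_mul_eq_one_right (h.trans ?_)
    simp [chiSqDensity, poissonWeight_zero_left]
  | succ n hle ih =>
    have h := integral_cexp_mul_chiSqDensity_succ n t
    obtain ⟨m, rfl⟩ := Nat.exists_eq_add_of_le' hle
    rw [ih m.succ_ne_zero, chiSqDensity, zero_div, poissonWeight_succ_zero, zero_div,
      ofReal_zero, mul_zero, add_zero] at h
    rw [pow_succ', ← h, chiSqTwoCharFun, inv_mul_cancel_left₀ (one_sub_two_mul_I_ne_zero t)]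

lemma charFun_withDensity_ofReal {μ : Measure ℝ} {f : ℝ → ℝ} (hf : AEMeasurable f μ)
    (hf0 : 0 ≤ᵐ[μ] f) (t : ℝ) :
    charFun (μ.withDensity fun s => ENNReal.ofReal (f s)) t =
      ∫ s, cexp (t * s * I) * (f s : ℂ) ∂μ := by
  rw [charFun_apply_real, integral_withDensity_eq_integral_toReal_smul₀ hf.ennreal_ofReal
    (ae_of_all _ fun _ => ENNReal.ofReal_lt_top)]
  refine integral_congr_ae (hf0.mono fun s hs => ?_)
  simp only [ENNReal.toReal_ofReal hs, Complex.real_smul, mul_comm]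

lemma hasSum_integral_cexp_mul_chiSqDensity {N : ℕ} (hN : N ≠ 0) {l : ℝ} (hl : 0 ≤ l) (t : ℝ) :
    HasSum (fun j => (poissonWeight j (l / 2) : ℂ) * chiSqTwoCharFun t ^ (N + j))
      (∫ s in Ioi (0 : ℝ), cexp (t * s * I) * (noncentralChiSqDensity N l s : ℂ)) := by
  have hl2 : 0 ≤ l / 2 := by positivity
  have hNj : ∀ j, N + j ≠ 0 := fun j => by omega
  let F : ℕ → ℝ → ℂ := fun j s =>
    poissonWeight j (l / 2) * (cexp (t * s * I) * (chiSqDensity (N + j) s : ℂ))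
  have hF : ∀ j, IntegrableOn (F j) (Ioi 0) := fun j =>
    (integrableOn_cexp_mul (integrableOn_chiSqDensity (N + j)) t).const_mul _
  have hnorm : ∀ j, ∫ s in Ioi (0 : ℝ), ‖F j s‖ = poissonWeight j (l / 2) := fun j => by
    simp only [F, norm_mul (poissonWeight j (l / 2) : ℂ), norm_cexp_mul_ofReal]
    rw [integral_const_mul, Complex.norm_real, Real.norm_of_nonneg (poissonWeight_nonneg j hl2),
      setIntegral_congr_fun measurableSet_Ioi fun s hs =>
        Real.norm_of_nonneg (chiSqDensity_nonneg (N + j) (le_of_lt hs)),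
      integral_chiSqDensity (hNj j), mul_one]
  have hsum := hasSum_integral_of_summable_integral_norm hF
    (by simpa only [hnorm] using (hasSum_poissonWeight (l / 2)).summable)
  simp only [F, integral_const_mul, integral_cexp_mul_chiSqDensity (hNj _)] at hsum
  convert! hsum using 3
  rw [tsum_congr fun j => mul_left_comm _ _ _, tsum_mul_left, noncentralChiSqDensity,
    poissonMixture, Complex.ofReal_tsum]
  push_cast
  rfl

lemma charFun_noncentralChiSq {N : ℕ} (hN : N ≠ 0) {l : ℝ} (hl : 0 ≤ l) (t : ℝ) :
    charFun (noncentralChiSq N l) t =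
      chiSqTwoCharFun t ^ N * cexp (l / 2 * (chiSqTwoCharFun t - 1)) := by
  have hexp := (NormedSpace.expSeries_div_hasSum_exp (𝔸 := ℂ)
    (l / 2 * chiSqTwoCharFun t)).mul_left (chiSqTwoCharFun t ^ N * cexp (-(l / 2)))
  rw [← Complex.exp_eq_exp_ℂ, mul_assoc, ← Complex.exp_add] at hexp
  rw [noncentralChiSq, charFun_withDensity_ofReal
    (integrableOn_noncentralChiSqDensity N hl).aemeasurable (ae_restrict_of_forall_mem
      measurableSet_Ioi fun s hs => noncentralChiSqDensity_nonneg N hl (le_of_lt hs))]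
  refine (hasSum_integral_cexp_mul_chiSqDensity hN hl t).unique ?_
  convert! hexp using 1
  · ext j
    rw [poissonWeight]
    push_cast
    ring
  · ring_nf

/-- The constant `c` is a square root of `chiSqTwoCharFun t`; since the dimension is even below,
only its square matters and no branch of the root has to be chosen. -/
lemma integral_cexp_sq_gaussianReal (t : ℝ) :
    ∃ c : ℂ, c ^ 2 = chiSqTwoCharFun t ∧ ∀ v : ℝ,
      ∫ x, cexp (t * ((x + v) ^ 2 : ℝ) * I) ∂gaussianReal 0 1 =
        c * cexp ((v ^ 2 / 2 : ℝ) * (chiSqTwoCharFun t - 1)) := by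
  have hw := one_sub_two_mul_I_ne_zero t
  have hb : (t * I - 1 / 2 : ℂ).re < 0 := by simp
  have hb' : (t * I - 1 / 2 : ℂ) = -(1 - 2 * t * I) / 2 := by ring
  have hpi : (Real.pi : ℂ) ≠ 0 := by exact_mod_cast Real.pi_ne_zero
  refine ⟨((√(2 * Real.pi))⁻¹ : ℝ) * (Real.pi / -(t * I - 1 / 2)) ^ (1 / 2 : ℂ), ?_, fun v => ?_⟩
  · rw [mul_pow, ← Complex.ofReal_pow, inv_pow, Real.sq_sqrt (by positivity), hb', one_div,
      Complex.cpow_ofNat_inv_pow, chiSqTwoCharFun]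
    push_cast
    field_simp
  · have hquad : ∀ x : ℝ, gaussianPDFReal 0 1 x • cexp (t * ((x + v) ^ 2 : ℝ) * I) =
        ((√(2 * Real.pi))⁻¹ : ℝ) *
          cexp ((t * I - 1 / 2) * x ^ 2 + (2 * t * v * I) * x + t * v ^ 2 * I) := fun x => by
      rw [gaussianPDFReal, Complex.real_smul, Complex.ofReal_mul, NNReal.coe_one, mul_one,
        mul_assoc, Complex.ofReal_exp, ← Complex.exp_add]
      congr 2
      push_cast
      ring
    simp_rw [integral_gaussianReal_eq_integral_smul one_ne_zero, hquad]
    rw [integral_const_mul, integral_cexp_quadratic hb, ← mul_assoc]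
    congr 2
    rw [hb', chiSqTwoCharFun]
    push_cast
    generalize hD : (1 - 2 * t * I : ℂ) = D at hw ⊢
    field_simp
    rw [← hD]
    ring

lemma map_sum_add_sq_pi_gaussianReal {ι : Type*} [Fintype ι] {N : ℕ} (hN : N ≠ 0)
    (hι : Fintype.card ι = 2 * N) (v : ι → ℝ) :
    (Measure.pi fun _ : ι => gaussianReal 0 1).map (fun w => ∑ i, (w i + v i) ^ 2) =
      noncentralChiSq N (∑ i, v i ^ 2) := by
  have hl : 0 ≤ ∑ i, v i ^ 2 := by positivity
  have hm : Measurable fun w : ι → ℝ => ∑ i, (w i + v i) ^ 2 := by fun_prop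
  have := isFiniteMeasure_noncentralChiSq N hl
  refine Measure.ext_of_charFun (funext fun t => ?_)
  obtain ⟨c, hc, hcv⟩ := integral_cexp_sq_gaussianReal t
  have hprod : ∀ w : ι → ℝ, cexp (t * ((∑ i, (w i + v i) ^ 2 : ℝ) : ℂ) * I) =
      ∏ i, cexp (t * ((w i + v i) ^ 2 : ℝ) * I) := fun w => by
    rw [← Complex.exp_sum, Complex.ofReal_sum, Finset.mul_sum, Finset.sum_mul]
  rw [charFun_noncentralChiSq hN hl, charFun_apply_real,
    integral_map hm.aemeasurable (by fun_prop)]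
  simp_rw [hprod]
  rw [integral_fintype_prod_eq_prod (fun i x => cexp (t * ((x + v i) ^ 2 : ℝ) * I))]
  simp_rw [hcv]
  rw [Finset.prod_mul_distrib, Finset.prod_const, Finset.card_univ, hι, pow_mul, hc,
    ← Complex.exp_sum, ← Finset.sum_mul, ← Complex.ofReal_sum, ← Finset.sum_div]
  push_cast
  rfl

end CharFun

section Outage

/-- The noncentrality parameter `μ² r / (1 - μ²)` of the normalized power of a port, given that the
squared norm of the common component of the channel is `r`. -/
noncomputable def portNoncentrality (μ r : ℝ) : ℝ := μ ^ 2 * r / (1 - μ ^ 2)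

lemma one_sub_sq_pos {μ : ℝ} (hμ : |μ| < 1) : 0 < 1 - μ ^ 2 :=
  sub_pos.2 ((sq_lt_one_iff_abs_lt_one μ).2 hμ)

variable {μ z r : ℝ} (N K : ℕ)

lemma portNoncentrality_nonneg (hμ : |μ| < 1) (hr : 0 ≤ r) : 0 ≤ portNoncentrality μ r :=
  div_nonneg (mul_nonneg (sq_nonneg μ) hr) (one_sub_sq_pos hμ).le

lemma measurable_portNoncentrality (μ : ℝ) : Measurable (portNoncentrality μ) := by
  unfold portNoncentrality; fun_prop

lemma gammaWeight_eq_chiSqDensity (r : ℝ) :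
    r ^ (N - 1) * Real.exp (-r / 2) / (2 ^ N * Real.Gamma N) = chiSqDensity N r := by
  cases N with
  | zero => simp [chiSqDensity]
  | succ n =>
    rw [Nat.add_sub_cancel, Nat.cast_add, Nat.cast_one, Real.Gamma_nat_eq_factorial, chiSqDensity,
      poissonWeight, div_pow, neg_div]
    field_simp
    ring

lemma outageIntegrand_eq (hμ : |μ| < 1) (hz : 0 ≤ z) (hr : 0 ≤ r) :
    outageIntegrand N K μ z r =
      chiSqDensity N r * (1 - noncentralChiSqTail N (portNoncentrality μ r) z) ^ K := by
  rw [outageIntegrand, gammaWeight_eq_chiSqDensity, ← portNoncentrality,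
    marcumQ_sqrt_sqrt N (portNoncentrality_nonneg hμ hr) hz]

lemma densityIntegrand_eq (hμ : |μ| < 1) (hz : 0 ≤ z) (hr : 0 ≤ r) :
    densityIntegrand N K μ z r = chiSqDensity N r *
      ((1 - noncentralChiSqTail N (portNoncentrality μ r) z) ^ (K - 1) *
        noncentralChiSqDensity N (portNoncentrality μ r) z) := by
  have hl := portNoncentrality_nonneg hμ hr
  have hweight : r ^ (N - 1) * Real.exp (-r / 2) / (2 ^ (N + 1) * Real.Gamma N) =
      chiSqDensity N r / 2 := by
    rw [← gammaWeight_eq_chiSqDensity]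
    ring
  rw [densityIntegrand, hweight, ← portNoncentrality, marcumQ_sqrt_sqrt _ hl hz,
    marcumQ_sqrt_sqrt _ hl hz]
  cases N with
  | zero => simp [chiSqDensity]
  | succ n =>
    rw [Nat.add_sub_cancel, noncentralChiSqTail_succ_sub n hl hz]
    ring

lemma one_sub_noncentralChiSqTail_mem_Icc (hμ : |μ| < 1) (hz : 0 ≤ z) (hr : 0 ≤ r) :
    1 - noncentralChiSqTail N (portNoncentrality μ r) z ∈ Icc (0 : ℝ) 1 :=
  have hl := portNoncentrality_nonneg hμ hr
  ⟨sub_nonneg.2 (noncentralChiSqTail_le_one N hl hz),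
    sub_le_self 1 (noncentralChiSqTail_nonneg N hl hz)⟩

lemma measurable_one_sub_noncentralChiSqTail (μ z : ℝ) :
    Measurable fun r => 1 - noncentralChiSqTail N (portNoncentrality μ r) z :=
  ((measurable_noncentralChiSqTail_left N z).comp (measurable_portNoncentrality μ)).const_sub 1

lemma aestronglyMeasurable_outageIntegrand (hμ : |μ| < 1) (hz : 0 ≤ z) :
    AEStronglyMeasurable (outageIntegrand N K μ z) (volume.restrict (Ioi 0)) := by
  have hm := (continuous_chiSqDensity N).measurable.mul
    ((measurable_one_sub_noncentralChiSqTail N μ z).pow_const K)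
  exact hm.aestronglyMeasurable.congr (ae_restrict_of_forall_mem measurableSet_Ioi fun r hr =>
    (outageIntegrand_eq N K hμ hz (le_of_lt hr)).symm)

lemma aestronglyMeasurable_densityIntegrand (hμ : |μ| < 1) (hz : 0 ≤ z) :
    AEStronglyMeasurable (densityIntegrand N K μ z) (volume.restrict (Ioi 0)) := by
  have hm := (continuous_chiSqDensity N).measurable.mul
    (((measurable_one_sub_noncentralChiSqTail N μ z).pow_const (K - 1)).mul
      ((measurable_noncentralChiSqDensity_left N z).comp (measurable_portNoncentrality μ)))
  exact hm.aestronglyMeasurable.congr (ae_restrict_of_forall_mem measurableSet_Ioi fun r hr =>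
    (densityIntegrand_eq N K hμ hz (le_of_lt hr)).symm)

lemma outageIntegrand_mem_Icc (hμ : |μ| < 1) (hz : 0 ≤ z) (hr : 0 ≤ r) :
    outageIntegrand N K μ z r ∈ Icc 0 (chiSqDensity N r) := by
  have hw := chiSqDensity_nonneg N hr
  obtain ⟨h0, h1⟩ := one_sub_noncentralChiSqTail_mem_Icc N hμ hz hr
  rw [outageIntegrand_eq N K hμ hz hr]
  exact ⟨mul_nonneg hw (pow_nonneg h0 K), mul_le_of_le_one_right hw (pow_le_one₀ h0 h1)⟩

lemma densityIntegrand_mem_Icc (hμ : |μ| < 1) (hz : 0 ≤ z) (hr : 0 ≤ r) :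
    densityIntegrand N K μ z r ∈ Icc 0 (chiSqDensity N r) := by
  have hw := chiSqDensity_nonneg N hr
  have hl := portNoncentrality_nonneg hμ hr
  have hk := noncentralChiSqDensity_nonneg N hl hz
  obtain ⟨h0, h1⟩ := one_sub_noncentralChiSqTail_mem_Icc N hμ hz hr
  rw [densityIntegrand_eq N K hμ hz hr]
  exact ⟨mul_nonneg hw (mul_nonneg (pow_nonneg h0 _) hk), mul_le_of_le_one_right hw
    (mul_le_one₀ (pow_le_one₀ h0 h1) hk (noncentralChiSqDensity_le_one N hl hz))⟩

lemma norm_le_of_mem_Icc {a b : ℝ} (h : a ∈ Icc 0 b) : ‖a‖ ≤ b :=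
  (Real.norm_of_nonneg h.1).trans_le h.2

lemma integrableOn_outageIntegrand (hμ : |μ| < 1) (hz : 0 ≤ z) :
    IntegrableOn (outageIntegrand N K μ z) (Ioi 0) :=
  (integrableOn_chiSqDensity N).mono' (aestronglyMeasurable_outageIntegrand N K hμ hz)
    (ae_restrict_of_forall_mem measurableSet_Ioi fun _ hr =>
      norm_le_of_mem_Icc (outageIntegrand_mem_Icc N K hμ hz (le_of_lt hr)))

lemma integrableOn_densityIntegrand (hμ : |μ| < 1) (hz : 0 ≤ z) :
    IntegrableOn (densityIntegrand N K μ z) (Ioi 0) :=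
  (integrableOn_chiSqDensity N).mono' (aestronglyMeasurable_densityIntegrand N K hμ hz)
    (ae_restrict_of_forall_mem measurableSet_Ioi fun _ hr =>
      norm_le_of_mem_Icc (densityIntegrand_mem_Icc N K hμ hz (le_of_lt hr)))

lemma maxDensity_nonneg (hμ : |μ| < 1) (hz : 0 ≤ z) : 0 ≤ maxDensity N K μ z :=
  mul_nonneg (Nat.cast_nonneg K) (setIntegral_nonneg measurableSet_Ioi fun _ hr =>
    (densityIntegrand_mem_Icc N K hμ hz (le_of_lt hr)).1)

lemma hasDerivAt_outageIntegrand (hμ : |μ| < 1) (hz : 0 < z) (hr : 0 ≤ r) :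
    HasDerivAt (fun s => outageIntegrand N K μ s r) (K * densityIntegrand N K μ z r) z := by
  have hd := (((hasDerivAt_noncentralChiSqTail N (portNoncentrality_nonneg hμ hr) hz).const_sub
    1).pow K).const_mul (chiSqDensity N r)
  refine HasDerivAt.congr_of_eventuallyEq ?_ ((lt_mem_nhds hz).mono fun s hs =>
    outageIntegrand_eq N K hμ (le_of_lt hs) hr)
  convert! hd using 1
  rw [densityIntegrand_eq N K hμ hz.le hr]
  ring

lemma hasDerivAt_integral_outageIntegrand (hμ : |μ| < 1) (hz : 0 < z) :
    HasDerivAt (fun s => ∫ r in Ioi (0 : ℝ), outageIntegrand N K μ s r) (maxDensity N K μ z) z := by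
  have h := (hasDerivAt_integral_of_dominated_loc_of_deriv_le (μ := volume.restrict (Ioi (0 : ℝ)))
    (F := outageIntegrand N K μ)
    (F' := fun s r => K * densityIntegrand N K μ s r) (x₀ := z) (s := Ioi 0)
    (bound := fun r => K * chiSqDensity N r) (Ioi_mem_nhds hz)
    ((lt_mem_nhds hz).mono fun s hs => aestronglyMeasurable_outageIntegrand N K hμ (le_of_lt hs))
    (integrableOn_outageIntegrand N K hμ hz.le)
    ((aestronglyMeasurable_densityIntegrand N K hμ hz.le).const_mul _)
    (ae_restrict_of_forall_mem measurableSet_Ioi fun r hr s hs => by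
      rw [norm_mul, Real.norm_natCast]
      exact mul_le_mul_of_nonneg_left (norm_le_of_mem_Icc
        (densityIntegrand_mem_Icc N K hμ (le_of_lt hs) (le_of_lt hr))) (Nat.cast_nonneg K))
    ((integrableOn_chiSqDensity N).const_mul _)
    (ae_restrict_of_forall_mem measurableSet_Ioi fun r hr s hs =>
      hasDerivAt_outageIntegrand N K hμ hs (le_of_lt hr))).2
  rwa [integral_const_mul] at h

lemma continuousOn_integral_outageIntegrand (hμ : |μ| < 1) :
    ContinuousOn (fun s => ∫ r in Ioi (0 : ℝ), outageIntegrand N K μ s r) (Ici 0) := by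
  refine continuousOn_of_dominated (bound := chiSqDensity N)
    (fun s hs => aestronglyMeasurable_outageIntegrand N K hμ hs)
    (fun s hs => ae_restrict_of_forall_mem measurableSet_Ioi fun r hr =>
      norm_le_of_mem_Icc (outageIntegrand_mem_Icc N K hμ hs (le_of_lt hr)))
    (integrableOn_chiSqDensity N) (ae_restrict_of_forall_mem measurableSet_Ioi fun r hr => ?_)
  have hr : 0 ≤ r := le_of_lt hr
  refine ContinuousOn.congr ?_ fun s hs => outageIntegrand_eq N K hμ hs hr
  have htail := continuousOn_noncentralChiSqTail N (portNoncentrality_nonneg hμ hr)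
  exact continuousOn_const.mul ((continuousOn_const.sub htail).pow K)

lemma aemeasurable_maxDensity (hμ : |μ| < 1) :
    AEMeasurable (maxDensity N K μ) (volume.restrict (Ioi 0)) :=
  (measurable_deriv fun s => ∫ r in Ioi (0 : ℝ), outageIntegrand N K μ s r).aemeasurable.congr
    (ae_restrict_of_forall_mem measurableSet_Ioi fun _ hz =>
      (hasDerivAt_integral_outageIntegrand N K hμ hz).deriv)

end Outage

section Channel

variable {Ω : Type*} {N K : ℕ} {μ P : ℝ} {x y : Fin N → Fin (K + 1) → Ω → ℝ}

/-- The Gaussian components of all the channels, grouped by port, so that they can be conditioned on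
those of index `0`, which all the ports share. -/
def componentArray (x y : Fin N → Fin (K + 1) → Ω → ℝ) (ω : Ω) (k : Fin (K + 1)) :
    Fin N ⊕ Fin N → ℝ :=
  Sum.elim (fun m => x m k ω) (fun m => y m k ω)

/-- The squared Euclidean norm of `w + c u`: the normalized power of a port with components `w`,
given the common components `u`. -/
def shiftedNormSq {ι : Type*} [Fintype ι] (c : ℝ) (u w : ι → ℝ) : ℝ :=
  ∑ i, (w i + c * u i) ^ 2

lemma measurable_shiftedNormSq {ι : Type*} [Fintype ι] (c : ℝ) :
    Measurable fun p : (ι → ℝ) × (ι → ℝ) => shiftedNormSq c p.1 p.2 := by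
  unfold shiftedNormSq; fun_prop

lemma normalizedPower_eq_shiftedNormSq (μ : ℝ) (x y : Fin N → Fin (K + 1) → Ω → ℝ) (k : Fin K)
    (ω : Ω) : normalizedPower μ x y k ω = shiftedNormSq (μ / Real.sqrt (1 - μ ^ 2))
      (componentArray x y ω 0) (componentArray x y ω k.succ) := by
  simp [normalizedPower, shiftedNormSq, componentArray, Fintype.sum_sum_type,
    Finset.sum_add_distrib]

lemma normalizedPower_nonneg (μ : ℝ) (x y : Fin N → Fin (K + 1) → Ω → ℝ) (k : Fin K) (ω : Ω) :
    0 ≤ normalizedPower μ x y k ω :=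
  Finset.sum_nonneg fun _ _ => by positivity

lemma maxNormalizedPower_nonneg (μ : ℝ) (x y : Fin N → Fin (K + 1) → Ω → ℝ) (ω : Ω) :
    0 ≤ maxNormalizedPower μ x y ω :=
  Real.iSup_nonneg fun k => normalizedPower_nonneg μ x y k ω

lemma maxNormalizedPower_le_sum (μ : ℝ) (x y : Fin N → Fin (K + 1) → Ω → ℝ) (ω : Ω) :
    maxNormalizedPower μ x y ω ≤ ∑ k, normalizedPower μ x y k ω :=
  have h0 : ∀ k ∈ Finset.univ, 0 ≤ normalizedPower μ x y k ω := fun k _ =>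
    normalizedPower_nonneg μ x y k ω
  Real.iSup_le (fun k => Finset.single_le_sum h0 (Finset.mem_univ k)) (Finset.sum_nonneg h0)

lemma maxNormalizedPower_lt_iff [Nonempty (Fin K)] {ω : Ω} {z : ℝ} :
    maxNormalizedPower μ x y ω < z ↔ ∀ k, normalizedPower μ x y k ω < z := by
  refine ⟨fun h k => (le_ciSup (finite_range _).bddAbove k).trans_lt h, fun h => ?_⟩
  obtain ⟨k, hk⟩ := exists_eq_ciSup_of_finite (f := fun k => normalizedPower μ x y k ω)
  exact hk.symm.trans_lt (h k)

lemma harvestPower_eq (hμ : |μ| < 1) (P : ℝ) (x y : Fin N → Fin (K + 1) → Ω → ℝ) (k : Fin K)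
    (ω : Ω) :
    harvestPower (fun _ => P) μ x y k ω = P * (1 - μ ^ 2) * normalizedPower μ x y k ω := by
  have hq0 : Real.sqrt (1 - μ ^ 2) ≠ 0 := (Real.sqrt_pos.2 (one_sub_sq_pos hμ)).ne'
  rw [harvestPower, normalizedPower, Finset.mul_sum]
  refine Finset.sum_congr rfl fun m _ => ?_
  rw [channelGain, mul_comm Complex.I, Complex.sq_norm, Complex.normSq_add_mul_I]
  field_simp
  rw [Real.sq_sqrt (one_sub_sq_pos hμ).le]

lemma harvestPower_argmax_eq (hμ : |μ| < 1) (hP : 0 ≤ P) {ω : Ω} {k₀ : Fin K}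
    (hk₀ : ∀ k, harvestPower (fun _ => P) μ x y k ω ≤ harvestPower (fun _ => P) μ x y k₀ ω) :
    harvestPower (fun _ => P) μ x y k₀ ω = P * (1 - μ ^ 2) * maxNormalizedPower μ x y ω := by
  have : Nonempty (Fin K) := ⟨k₀⟩
  have hmax : harvestPower (fun _ => P) μ x y k₀ ω = ⨆ k, harvestPower (fun _ => P) μ x y k ω :=
    le_antisymm (le_ciSup (f := fun k => harvestPower (fun _ => P) μ x y k ω)
      (finite_range _).bddAbove k₀) (ciSup_le hk₀)
  rw [hmax, maxNormalizedPower, Real.mul_iSup_of_nonneg (mul_nonneg hP (one_sub_sq_pos hμ).le)]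
  simp only [harvestPower_eq hμ]

lemma avgHarvestedEnergy_eq [MeasurableSpace Ω] (ρ : Measure Ω) (hμ : |μ| < 1) (hP : 0 ≤ P)
    (α T : ℝ) {kstar : Ω → Fin K} (hkstar : ∀ ω k, harvestPower (fun _ => P) μ x y k ω ≤
      harvestPower (fun _ => P) μ x y (kstar ω) ω) :
    avgHarvestedEnergy ρ α T (fun _ => P) μ x y kstar =
      (1 - α) * (1 - μ ^ 2) * T * P * ∫ ω, maxNormalizedPower μ x y ω ∂ρ := by
  simp only [avgHarvestedEnergy, fun ω => harvestPower_argmax_eq hμ hP (hkstar ω),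
    integral_const_mul]
  ring

end Channel

section ChannelLaw

variable {Ω : Type*} [MeasurableSpace Ω] {ρ : Measure Ω} {N K : ℕ}
  {x y : Fin N → Fin (K + 1) → Ω → ℝ}

lemma hasLaw_curry_of_iIndepFun [IsProbabilityMeasure ρ] {ι κ E : Type*} [Fintype ι] [Fintype κ]
    [MeasurableSpace E] {γ : Measure E} [IsProbabilityMeasure γ] {f : ι → κ → Ω → E}
    (hf : ∀ i j, HasLaw (f i j) γ ρ) (hindep : iIndepFun (fun p : ι × κ => f p.1 p.2) ρ) :
    HasLaw (fun ω i j => f i j ω) (Measure.pi fun _ => Measure.pi fun _ => γ) ρ := by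
  have hcurry := Measure.infinitePi_map_curry (ι := ι) (κ := κ) fun _ _ => γ
  simp only [Measure.infinitePi_eq_pi] at hcurry
  exact HasLaw.comp ⟨(MeasurableEquiv.measurable _).aemeasurable, hcurry⟩
    (hindep.hasLaw_pi fun p => hf p.1 p.2)

lemma hasLaw_componentArray [IsProbabilityMeasure ρ]
    (hx : ∀ m k, HasLaw (x m k) (gaussianReal 0 1) ρ)
    (hy : ∀ m k, HasLaw (y m k) (gaussianReal 0 1) ρ)
    (hindep : iIndepFun (Sum.elim (fun p : Fin N × Fin (K + 1) => x p.1 p.2)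
      (fun p : Fin N × Fin (K + 1) => y p.1 p.2)) ρ) :
    HasLaw (componentArray x y)
      (Measure.pi fun _ => Measure.pi fun _ => gaussianReal 0 1) ρ := by
  let e : Fin (K + 1) × (Fin N ⊕ Fin N) → (Fin N × Fin (K + 1)) ⊕ (Fin N × Fin (K + 1)) :=
    fun p => p.2.map (fun m => (m, p.1)) (fun m => (m, p.1))
  have he : Function.Injective e := by
    rintro ⟨k, m | m⟩ ⟨k', m' | m'⟩ h <;> simp_all [e]
  refine hasLaw_curry_of_iIndepFun (f := fun k j ω => componentArray x y ω k j) ?_ ?_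
  · rintro k (m | m)
    · exact hx m k
    · exact hy m k
  · convert! hindep.precomp he using 1
    ext ⟨k, m | m⟩ ω <;> rfl

lemma aemeasurable_maxNormalizedPower (hx : ∀ m k, AEMeasurable (x m k) ρ)
    (hy : ∀ m k, AEMeasurable (y m k) ρ) (μ : ℝ) : AEMeasurable (maxNormalizedPower μ x y) ρ := by
  unfold maxNormalizedPower normalizedPower
  fun_prop

lemma integrable_normalizedPower (hx : ∀ m k, MemLp (x m k) 2 ρ) (hy : ∀ m k, MemLp (y m k) 2 ρ)
    (μ : ℝ) (k : Fin K) : Integrable (normalizedPower μ x y k) ρ :=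
  integrable_finsetSum _ fun m _ =>
    ((hx m k.succ).add ((hx m 0).const_mul _)).integrable_sq.add
      ((hy m k.succ).add ((hy m 0).const_mul _)).integrable_sq

lemma integrable_maxNormalizedPower (hx : ∀ m k, MemLp (x m k) 2 ρ)
    (hy : ∀ m k, MemLp (y m k) 2 ρ) (μ : ℝ) : Integrable (maxNormalizedPower μ x y) ρ :=
  (integrable_finsetSum _ fun k _ => integrable_normalizedPower hx hy μ k).mono'
    (aemeasurable_maxNormalizedPower (fun m k => (hx m k).aemeasurable)
      (fun m k => (hy m k).aemeasurable) μ).aestronglyMeasurable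
    (ae_of_all _ fun ω => (Real.norm_of_nonneg (maxNormalizedPower_nonneg μ x y ω)).trans_le
      (maxNormalizedPower_le_sum μ x y ω))

lemma memLp_two_of_hasLaw_gaussianReal {X : Ω → ℝ} (hX : HasLaw X (gaussianReal 0 1) ρ) :
    MemLp X 2 ρ := by
  have h := memLp_id_gaussianReal (μ := 0) (v := 1) 2
  rw [← hX.map_eq] at h
  exact (memLp_map_measure_iff (by fun_prop) hX.aemeasurable).1 h

end ChannelLaw

section Conditioning

lemma pi_setOf_forall_zero_succ_mem {E : Type*} [MeasurableSpace E] (γ : Measure E)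
    [SigmaFinite γ] (K : ℕ) {B : Set (E × E)} (hB : MeasurableSet B) :
    (Measure.pi fun _ : Fin (K + 1) => γ) {w | ∀ k : Fin K, (w 0, w k.succ) ∈ B} =
      ∫⁻ u, γ (Prod.mk u ⁻¹' B) ^ K ∂γ := by
  let C : Set (E × (Fin K → E)) := {p | ∀ k, (p.1, p.2 k) ∈ B}
  have hC : MeasurableSet C := by
    have : C = ⋂ k, (fun p => (p.1, p.2 k)) ⁻¹' B := by ext; simp [C]
    rw [this]
    exact MeasurableSet.iInter fun k => hB.preimage (by fun_prop)
  have hCu : ∀ u, Prod.mk u ⁻¹' C = univ.pi fun _ : Fin K => Prod.mk u ⁻¹' B := fun u => by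
    ext; simp [C]
  calc (Measure.pi fun _ : Fin (K + 1) => γ) {w | ∀ k : Fin K, (w 0, w k.succ) ∈ B}
      = (γ.prod (Measure.pi fun _ : Fin K => γ)) C :=
        (measurePreserving_piFinSuccAbove (fun _ : Fin (K + 1) => γ) 0).measure_preimage
          hC.nullMeasurableSet
    _ = ∫⁻ u, γ (Prod.mk u ⁻¹' B) ^ K ∂γ := by
        simp only [Measure.prod_apply hC, hCu, Measure.pi_pi, Finset.prod_const, Finset.card_univ,
          Fintype.card_fin]

variable {ι : Type*} [Fintype ι] {N : ℕ}

lemma pi_gaussianReal_shiftedNormSq_lt (hN : N ≠ 0) (hι : Fintype.card ι = 2 * N) (c : ℝ)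
    (u : ι → ℝ) {z : ℝ} (hz : 0 ≤ z) :
    (Measure.pi fun _ : ι => gaussianReal 0 1) {w | shiftedNormSq c u w < z} =
      ENNReal.ofReal (1 - noncentralChiSqTail N (c ^ 2 * ∑ i, u i ^ 2) z) := by
  have h := map_sum_add_sq_pi_gaussianReal hN hι fun i => c * u i
  simp only [mul_pow, ← Finset.mul_sum] at h
  rw [← noncentralChiSq_Iio hN (by positivity) hz, ← h, Measure.map_apply (by fun_prop)
    measurableSet_Iio]
  rfl

lemma hasLaw_sum_sq_pi_gaussianReal (hN : N ≠ 0) (hι : Fintype.card ι = 2 * N) :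
    HasLaw (fun w : ι → ℝ => ∑ i, w i ^ 2) (noncentralChiSq N 0)
      (Measure.pi fun _ => gaussianReal 0 1) :=
  ⟨Measurable.aemeasurable (by fun_prop),
    by simpa using map_sum_add_sq_pi_gaussianReal hN hι fun _ => 0⟩

lemma measurableSet_forall_shiftedNormSq_lt (K : ℕ) (c z : ℝ) :
    MeasurableSet {w : Fin (K + 1) → ι → ℝ |
      ∀ k : Fin K, shiftedNormSq c (w 0) (w k.succ) < z} := by
  rw [ofPred_forall]
  refine MeasurableSet.iInter fun k => measurableSet_lt ?_ measurable_const
  have hpair : Measurable fun w : Fin (K + 1) → ι → ℝ => (w 0, w k.succ) := by fun_prop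
  exact (measurable_shiftedNormSq c).comp hpair

lemma pi_pi_gaussianReal_forall_shiftedNormSq_lt (K : ℕ) (hN : N ≠ 0)
    (hι : Fintype.card ι = 2 * N) (c : ℝ) {z : ℝ} (hz : 0 ≤ z) :
    (Measure.pi fun _ : Fin (K + 1) => Measure.pi fun _ : ι => gaussianReal 0 1)
        {w | ∀ k : Fin K, shiftedNormSq c (w 0) (w k.succ) < z} =
      ∫⁻ r, ENNReal.ofReal (1 - noncentralChiSqTail N (c ^ 2 * r) z) ^ K
        ∂noncentralChiSq N 0 := by
  have hm : Measurable fun r => ENNReal.ofReal (1 - noncentralChiSqTail N (c ^ 2 * r) z) ^ K :=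
    (((measurable_noncentralChiSqTail_left N z).comp
      (measurable_const_mul _)).const_sub 1).ennreal_ofReal.pow_const K
  rw [← (hasLaw_sum_sq_pi_gaussianReal hN hι).lintegral_comp hm.aemeasurable]
  simp only [← pi_gaussianReal_shiftedNormSq_lt hN hι c _ hz]
  exact pi_setOf_forall_zero_succ_mem _ K
    (measurableSet_lt (measurable_shiftedNormSq c) measurable_const)

end Conditioning

section Distribution

variable {Ω : Type*} [MeasurableSpace Ω] {ρ : Measure Ω} {N K : ℕ}
  {x y : Fin N → Fin (K + 1) → Ω → ℝ} {μ z : ℝ}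

lemma sq_div_sqrt_mul_eq_portNoncentrality (hμ : |μ| < 1) (r : ℝ) :
    (μ / Real.sqrt (1 - μ ^ 2)) ^ 2 * r = portNoncentrality μ r := by
  rw [div_pow, Real.sq_sqrt (one_sub_sq_pos hμ).le, portNoncentrality]
  ring

lemma measure_maxNormalizedPower_lt [Nonempty (Fin K)] (hN : N ≠ 0) (hμ : |μ| < 1)
    (hlaw : HasLaw (componentArray x y)
      (Measure.pi fun _ => Measure.pi fun _ => gaussianReal 0 1) ρ) (hz : 0 ≤ z) :
    ρ {ω | maxNormalizedPower μ x y ω < z} =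
      ∫⁻ r, ENNReal.ofReal (1 - noncentralChiSqTail N (portNoncentrality μ r) z) ^ K
        ∂noncentralChiSq N 0 := by
  have hcard : Fintype.card (Fin N ⊕ Fin N) = 2 * N := by simp [two_mul]
  simp only [maxNormalizedPower_lt_iff, normalizedPower_eq_shiftedNormSq]
  rw [hlaw.measure_eq (measurableSet_forall_shiftedNormSq_lt K _ z),
    pi_pi_gaussianReal_forall_shiftedNormSq_lt K hN hcard _ hz]
  simp only [sq_div_sqrt_mul_eq_portNoncentrality hμ]

lemma lintegral_noncentralChiSq_zero (N : ℕ) {f : ℝ → ENNReal} (hf : Measurable f) :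
    ∫⁻ r, f r ∂noncentralChiSq N 0 =
      ∫⁻ r in Ioi (0 : ℝ), ENNReal.ofReal (chiSqDensity N r) * f r := by
  simp only [noncentralChiSq, noncentralChiSqDensity_zero]
  exact lintegral_withDensity_eq_lintegral_mul _
    (continuous_chiSqDensity N).measurable.ennreal_ofReal hf

lemma measureReal_maxNormalizedPower_lt [Nonempty (Fin K)] (hN : N ≠ 0) (hμ : |μ| < 1)
    (hlaw : HasLaw (componentArray x y)
      (Measure.pi fun _ => Measure.pi fun _ => gaussianReal 0 1) ρ) (hz : 0 ≤ z) :
    ρ.real {ω | maxNormalizedPower μ x y ω < z} =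
      ∫ r in Ioi (0 : ℝ), outageIntegrand N K μ z r := by
  have hintegrand : ∀ r ∈ Ioi (0 : ℝ), ENNReal.ofReal (chiSqDensity N r) *
      ENNReal.ofReal (1 - noncentralChiSqTail N (portNoncentrality μ r) z) ^ K =
        ENNReal.ofReal (outageIntegrand N K μ z r) := fun r hr => by
    have hr : 0 ≤ r := le_of_lt hr
    rw [outageIntegrand_eq N K hμ hz hr, ENNReal.ofReal_mul (chiSqDensity_nonneg N hr),
      ENNReal.ofReal_pow (one_sub_noncentralChiSqTail_mem_Icc N hμ hz hr).1]
  have hH := (measurable_one_sub_noncentralChiSqTail N μ z).ennreal_ofReal.pow_const K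
  rw [measureReal_def, measure_maxNormalizedPower_lt hN hμ hlaw hz,
    lintegral_noncentralChiSq_zero N hH, setLIntegral_congr_fun measurableSet_Ioi hintegrand,
    ← integral_eq_lintegral_of_nonneg_ae (ae_restrict_of_forall_mem measurableSet_Ioi fun r hr =>
      (outageIntegrand_mem_Icc N K hμ hz (le_of_lt hr)).1)
      (aestronglyMeasurable_outageIntegrand N K hμ hz)]

lemma map_maxNormalizedPower [IsFiniteMeasure ρ] (hμ : |μ| < 1)
    (hZ : AEMeasurable (maxNormalizedPower μ x y) ρ)
    (hcdf : ∀ z, 0 ≤ z → ρ.real {ω | maxNormalizedPower μ x y ω < z} =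
      ∫ r in Ioi (0 : ℝ), outageIntegrand N K μ z r) :
    ρ.map (maxNormalizedPower μ x y) =
      (volume.restrict (Ioi (0 : ℝ))).withDensity
        fun t => ENNReal.ofReal (maxDensity N K μ t) := by
  have hcdf0 : ∫ r in Ioi (0 : ℝ), outageIntegrand N K μ 0 r = 0 := by
    have hempty : {ω | maxNormalizedPower μ x y ω < 0} = ∅ :=
      eq_empty_of_forall_notMem fun ω => (maxNormalizedPower_nonneg μ x y ω).not_gt
    rw [← hcdf 0 le_rfl, hempty, measureReal_empty]
  refine eq_withDensity_ofReal_deriv (continuousOn_integral_outageIntegrand N K hμ)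
    (fun z hz => hasDerivAt_integral_outageIntegrand N K hμ hz)
    (fun z hz => maxDensity_nonneg N K hμ (le_of_lt hz)) fun z hz => ?_
  rw [Measure.map_apply_of_aemeasurable hZ measurableSet_Iio, hcdf0, sub_zero, ← hcdf z hz,
    ofReal_measureReal]
  rfl

end Distribution

section Mean

variable {Ω : Type*} [MeasurableSpace Ω] {ρ : Measure Ω} {ν : Measure ℝ} {X : Ω → ℝ} {f : ℝ → ℝ}

lemma integrable_mul_iff_of_hasLaw_withDensity (hf : AEMeasurable f ν) (hf0 : 0 ≤ᵐ[ν] f)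
    (hX : HasLaw X (ν.withDensity fun t => ENNReal.ofReal (f t)) ρ) :
    Integrable (fun t => t * f t) ν ↔ Integrable X ρ := by
  have hX' : Integrable X ρ ↔ Integrable (fun t : ℝ => t) (ρ.map X) :=
    (integrable_map_measure aestronglyMeasurable_id hX.aemeasurable).symm
  rw [hX', hX.map_eq, integrable_withDensity_iff_integrable_smul₀' hf.ennreal_ofReal
    (ae_of_all _ fun _ => ENNReal.ofReal_lt_top)]
  refine integrable_congr (hf0.mono fun t ht => ?_)
  simp only [ENNReal.toReal_ofReal ht, smul_eq_mul, mul_comm]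

lemma integral_eq_of_hasLaw_withDensity (hf : AEMeasurable f ν) (hf0 : 0 ≤ᵐ[ν] f)
    (hX : HasLaw X (ν.withDensity fun t => ENNReal.ofReal (f t)) ρ) :
    ∫ ω, X ω ∂ρ = ∫ t, t * f t ∂ν := by
  rw [hX.integral_eq, integral_withDensity_eq_integral_toReal_smul₀ hf.ennreal_ofReal
    (ae_of_all _ fun _ => ENNReal.ofReal_lt_top)]
  refine integral_congr_ae (hf0.mono fun t ht => ?_)
  simp only [ENNReal.toReal_ofReal ht, smul_eq_mul, mul_comm]

end Mean

theorem theorem3_general {Ω : Type*} [MeasurableSpace Ω] (ρ : Measure Ω) [IsProbabilityMeasure ρ]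
    {N K : ℕ} (hN : N ≠ 0) {μ P : ℝ} (T α : ℝ) (hμ : |μ| < 1) (hP : 0 ≤ P)
    {x y : Fin N → Fin (K + 1) → Ω → ℝ}
    (hx : ∀ m k, HasLaw (x m k) (gaussianReal 0 1) ρ)
    (hy : ∀ m k, HasLaw (y m k) (gaussianReal 0 1) ρ)
    (hindep : iIndepFun (Sum.elim (fun p : Fin N × Fin (K + 1) => x p.1 p.2)
      (fun p : Fin N × Fin (K + 1) => y p.1 p.2)) ρ)
    {kstar : Ω → Fin K}
    (hkstar : ∀ ω k, harvestPower (fun _ => P) μ x y k ω ≤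
      harvestPower (fun _ => P) μ x y (kstar ω) ω) :
    (Integrable (fun ω => harvestPower (fun _ => P) μ x y (kstar ω) ω) ρ ∧
      Integrable (maxNormalizedPower μ x y) ρ ∧
      avgHarvestedEnergy ρ α T (fun _ => P) μ x y kstar =
        (1 - α) * (1 - μ ^ 2) * T * P * ∫ ω, maxNormalizedPower μ x y ω ∂ρ) ∧
    (∀ z : ℝ, 0 ≤ z →
      IntegrableOn (outageIntegrand N K μ z) (Ioi 0) ∧
      ρ.real {ω | maxNormalizedPower μ x y ω < z} =
        ∫ r in Ioi (0 : ℝ), outageIntegrand N K μ z r) ∧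
    (∀ z : ℝ, 0 < z →
      (∀ r : ℝ, 0 < r → HasDerivAt (fun s => outageIntegrand N K μ s r)
        (K * densityIntegrand N K μ z r) z) ∧
      IntegrableOn (densityIntegrand N K μ z) (Ioi 0) ∧
      HasDerivAt (fun s => ∫ r in Ioi (0 : ℝ), outageIntegrand N K μ s r)
        (maxDensity N K μ z) z) ∧
    (ρ.map (maxNormalizedPower μ x y) =
      (volume.restrict (Ioi (0 : ℝ))).withDensity
        (fun t => ENNReal.ofReal (maxDensity N K μ t))) ∧
    IntegrableOn (fun t : ℝ => t * maxDensity N K μ t) (Ioi 0) ∧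
    avgHarvestedEnergy ρ α T (fun _ => P) μ x y kstar =
      (1 - α) * (1 - μ ^ 2) * T * P * ∫ t in Ioi (0 : ℝ), t * maxDensity N K μ t ∧
    avgHarvestedEnergy ρ α T (fun _ => P) μ x y kstar =
      (1 - α) * (1 - μ ^ 2) * T * P * ∫ t in Ioi (0 : ℝ), K * t * ∫ r in Ioi (0 : ℝ),
        r ^ (N - 1) * Real.exp (-r / 2) / (2 ^ (N + 1) * Real.Gamma N) *
        (1 - marcumQ N (Real.sqrt (μ ^ 2 * r / (1 - μ ^ 2))) (Real.sqrt t)) ^ (K - 1) *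
        (marcumQ N (Real.sqrt (μ ^ 2 * r / (1 - μ ^ 2))) (Real.sqrt t) -
          marcumQ (N - 1) (Real.sqrt (μ ^ 2 * r / (1 - μ ^ 2))) (Real.sqrt t)) := by
  have : Nonempty (Fin K) := (nonempty_of_isProbabilityMeasure ρ).map kstar
  have hZ : Integrable (maxNormalizedPower μ x y) ρ :=
    integrable_maxNormalizedPower (fun m k => memLp_two_of_hasLaw_gaussianReal (hx m k))
      (fun m k => memLp_two_of_hasLaw_gaussianReal (hy m k)) μ
  have hE := avgHarvestedEnergy_eq ρ hμ hP α T hkstar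
  have hcdf := fun z (hz : 0 ≤ z) =>
    measureReal_maxNormalizedPower_lt hN hμ (hasLaw_componentArray hx hy hindep) hz
  have hlaw : HasLaw (maxNormalizedPower μ x y) _ ρ :=
    ⟨hZ.aemeasurable, map_maxNormalizedPower hμ hZ.aemeasurable hcdf⟩
  have hf := aemeasurable_maxDensity N K hμ
  have hf0 : 0 ≤ᵐ[volume.restrict (Ioi 0)] maxDensity N K μ :=
    ae_restrict_of_forall_mem measurableSet_Ioi fun t ht => maxDensity_nonneg N K hμ (le_of_lt ht)
  have hmean := integral_eq_of_hasLaw_withDensity hf hf0 hlaw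
  refine ⟨⟨?_, hZ, hE⟩, fun z hz => ⟨integrableOn_outageIntegrand N K hμ hz, hcdf z hz⟩,
    fun z hz => ⟨fun r hr => hasDerivAt_outageIntegrand N K hμ hz hr.le,
      integrableOn_densityIntegrand N K hμ hz.le, hasDerivAt_integral_outageIntegrand N K hμ hz⟩,
    hlaw.map_eq, (integrable_mul_iff_of_hasLaw_withDensity hf hf0 hlaw).2 hZ, hmean ▸ hE, ?_⟩
  · simpa only [fun ω => harvestPower_argmax_eq hμ hP (hkstar ω)] using hZ.const_mul _
  · rw [hE, hmean]
    simp only [maxDensity, densityIntegrand, mul_left_comm, mul_assoc]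

theorem theorem3 {Ω : Type*} [MeasurableSpace Ω] (ρ : Measure Ω) [IsProbabilityMeasure ρ]
    {N K : ℕ} (hK : 1 ≤ K) (i : Fin N) (μ P T : ℝ) (α : Fin N → ℝ)
    (hμ0 : 0 ≤ μ) (hμ1 : μ < 1) (hP : 0 < P)
    -- `x m i k`, `y m i k`: the Gaussian components of the channel from AP `m` to user `i`
    (x y : Fin N → Fin N → Fin (K + 1) → Ω → ℝ)
    (hx : ∀ m k, HasLaw (x m i k) (gaussianReal 0 1) ρ)
    (hy : ∀ m k, HasLaw (y m i k) (gaussianReal 0 1) ρ)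
    (hindep : iIndepFun (Sum.elim (fun p : Fin N × Fin (K + 1) => x p.1 i p.2)
      (fun p : Fin N × Fin (K + 1) => y p.1 i p.2)) ρ)
    -- `kstar` is the port that maximizes the harvested power of user `i`
    (kstar : Ω → Fin K)
    (hkstar : ∀ ω k, harvestPower (fun _ => P) μ (fun m => x m i) (fun m => y m i) k ω ≤
      harvestPower (fun _ => P) μ (fun m => x m i) (fun m => y m i) (kstar ω) ω) :
    -- the expectations exist, and `E_avg = ψ_i E[max_k Y_k]`
    (Integrable (fun ω => harvestPower (fun _ => P) μ (fun m => x m i) (fun m => y m i)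
        (kstar ω) ω) ρ ∧
      Integrable (maxNormalizedPower μ (fun m => x m i) (fun m => y m i)) ρ ∧
      avgHarvestedEnergy ρ (α i) T (fun _ => P) μ (fun m => x m i) (fun m => y m i) kstar =
        (1 - α i) * (1 - μ ^ 2) * T * P *
          ∫ ω, maxNormalizedPower μ (fun m => x m i) (fun m => y m i) ω ∂ρ) ∧
    -- the distribution function of `Z` is the outage-probability integral
    (∀ z : ℝ, 0 ≤ z →
      IntegrableOn (outageIntegrand N K μ z) (Ioi 0) ∧
      ρ.real {ω | maxNormalizedPower μ (fun m => x m i) (fun m => y m i) ω < z} =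
        ∫ r in Ioi (0 : ℝ), outageIntegrand N K μ z r) ∧
    -- it can be differentiated under the integral sign, and the derivative is `f_Z`
    (∀ z : ℝ, 0 < z →
      (∀ r : ℝ, 0 < r → HasDerivAt (fun s => outageIntegrand N K μ s r)
        (K * densityIntegrand N K μ z r) z) ∧
      IntegrableOn (densityIntegrand N K μ z) (Ioi 0) ∧
      HasDerivAt (fun s => ∫ r in Ioi (0 : ℝ), outageIntegrand N K μ s r)
        (maxDensity N K μ z) z) ∧
    -- `f_Z` is the density of `Z`
    (ρ.map (maxNormalizedPower μ (fun m => x m i) (fun m => y m i)) =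
      (volume.restrict (Ioi (0 : ℝ))).withDensity
        (fun t => ENNReal.ofReal (maxDensity N K μ t))) ∧
    -- the average harvested energy as `ψ_i ∫ t f_Z(t) dt`, and written out as a double integral
    IntegrableOn (fun t : ℝ => t * maxDensity N K μ t) (Ioi 0) ∧
    avgHarvestedEnergy ρ (α i) T (fun _ => P) μ (fun m => x m i) (fun m => y m i) kstar =
      (1 - α i) * (1 - μ ^ 2) * T * P * ∫ t in Ioi (0 : ℝ), t * maxDensity N K μ t ∧
    avgHarvestedEnergy ρ (α i) T (fun _ => P) μ (fun m => x m i) (fun m => y m i) kstar =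
      (1 - α i) * (1 - μ ^ 2) * T * P * ∫ t in Ioi (0 : ℝ), K * t * ∫ r in Ioi (0 : ℝ),
        r ^ (N - 1) * Real.exp (-r / 2) / (2 ^ (N + 1) * Real.Gamma N) *
        (1 - marcumQ N (Real.sqrt (μ ^ 2 * r / (1 - μ ^ 2))) (Real.sqrt t)) ^ (K - 1) *
        (marcumQ N (Real.sqrt (μ ^ 2 * r / (1 - μ ^ 2))) (Real.sqrt t) -
          marcumQ (N - 1) (Real.sqrt (μ ^ 2 * r / (1 - μ ^ 2))) (Real.sqrt t)) :=
  theorem3_general ρ i.pos.ne' T (α i) (abs_lt.2 ⟨by linarith, hμ1⟩) hP.le hx hy hindep hkstar
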